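/- Let $\mathbb S^2\subset\mathbb R^3$ be the unit sphere and let $h:\mathbb S^2\to\mathbb R$ be a function of class $C^2$. The hedgehog with support function $h$ is the set $\mathcal H_h=x_h(\mathbb S^2)\subset\mathbb R^3$, where $$x_h:\mathbb S^2\to\mathbb R^3,\qquad x_h(p)=(\operatorname{grad} h)(p)+h(p)\,p ,$$ and $\operatorname{grad} h$ is the gradient of $h$ on $\mathbb S^2$, regarded as a vector of $\mathbb R^3$ tangent to $\mathbb S^2$. The tangent map $T_px_h$ is an endomorphism of $T_p\mathbb S^2=p^\perp$, and the curvature function of $\mathcal H_h$ is $R_h(p)=\det(T_px_h)$. For $n\in\mathbb S^2$, a point $s\in\mathcal H_h$ is called extremal for $\mathcal H_h$ in the direction $n$ if $\langle x_h(p),n\rangle\le\langle s,n\rangle$ for all $p\in\mathbb S^2$. Suppose that $R_h(p)\le 0$ for all $p\in\mathbb S^2$ and that $\mathcal H_h$ is not a single point. Then there exist a direction $n\in\mathbb S^2$, an extremal point $s$ of $\mathcal H_h$ in the direction $n$, and a half great circle $C\subset\mathbb S^2$ joining $-n$ and $n$ (end points included) such that the spherical image $x_h^{-1}(s)=\{p\in\mathbb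 S^2 : x_h(p)=s\}$ does not meet $C$. -/

import Mathlib

open scoped Manifold ContDiff RealInnerProductSpace

noncomputable section

namespace Hedgehog

/-- Euclidean space `ℝ³`. -/
abbrev E3 : Type := EuclideanSpace ℝ (Fin 3)

/-- The unit sphere `S² ⊂ ℝ³` (with Mathlib's smooth manifold structure). -/
abbrev S2 : Type := Metric.sphere (0 : E3) 1

/-- The point `u / ‖u‖` of the sphere, for `u ≠ 0`. -/
def toSphere (u : E3) (hu : u ≠ 0) : S2 :=
  ⟨‖u‖⁻¹ • u, by
    rw [mem_sphere_zero_iff_norm, norm_smul, norm_inv, norm_norm,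
      inv_mul_cancel₀ (norm_ne_zero_iff.mpr hu)]⟩

open Classical in
/-- The radially constant extension `u ↦ g (u / ‖u‖)` to `ℝ³ ∖ {0}` of a map `g` defined on the
sphere (with the irrelevant value `0` at the origin). -/
def radialExt {F : Type*} [Zero F] (g : S2 → F) (u : E3) : F :=
  if hu : u ≠ 0 then g (toSphere u hu) else 0

/-- The gradient of `h : S² → ℝ` on the round sphere, as a vector of `ℝ³` tangent to the sphere.
It is the Euclidean gradient at `p` of the radially constant extension of `h`: the latter is
orthogonal to `p` and represents the differential of `h` on the tangent plane `p^⊥`. -/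
def sphereGrad (h : S2 → ℝ) (p : S2) : E3 :=
  gradient (radialExt h) (p : E3)

/-- The parametrization `x_h(p) = (grad h)(p) + h(p) p` of the hedgehog with support
function `h`. -/
def param (h : S2 → ℝ) (p : S2) : E3 :=
  sphereGrad h p + h p • (p : E3)

/-- The hedgehog `H_h = x_h(S²)` with support function `h`. -/
def hedgehog (h : S2 → ℝ) : Set E3 :=
  Set.range (param h)

/-- The tangent plane `T_p S² = p^⊥`. -/
abbrev tangentPlane (p : S2) : Submodule ℝ E3 :=
  (ℝ ∙ (p : E3))ᗮ

/-- The tangent map `T_p x_h` as an endomorphism of `T_p S² = p^⊥`. It is the restriction to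
`p^⊥` of the derivative at `p` of the radially constant extension of `x_h`. For `h` of class `C²`
this derivative takes values in `p^⊥`, so that the orthogonal projection only
adjusts the codomain. -/
def tangentEnd (h : S2 → ℝ) (p : S2) : tangentPlane p →L[ℝ] tangentPlane p :=
  (tangentPlane p).orthogonalProjectionOnto ∘L
    (fderiv ℝ (radialExt (param h)) (p : E3) ∘L (tangentPlane p).subtypeL)

/-- The curvature function `R_h(p) = det (T_p x_h)`. -/
def curvature (h : S2 → ℝ) (p : S2) : ℝ :=
  LinearMap.det (tangentEnd h p : tangentPlane p →ₗ[ℝ] tangentPlane p)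

/-- `s` is an extremal point of the hedgehog `H_h` in the direction `n`. -/
def IsExtremalPoint (h : S2 → ℝ) (n : S2) (s : E3) : Prop :=
  s ∈ hedgehog h ∧ ∀ p : S2, ⟪param h p, (n : E3)⟫ ≤ ⟪s, (n : E3)⟫

/-- `C` is a half great circle joining `-n` and `n` on the sphere (end points included): for some
unit vector `v` orthogonal to `n`, it is the arc `cos t • n + sin t • v`, `0 ≤ t ≤ π`. -/
def IsHalfGreatCircle (n : S2) (C : Set S2) : Prop :=
  ∃ v : S2, ⟪(n : E3), (v : E3)⟫ = 0 ∧
    C = {q : S2 | ∃ t ∈ Set.Icc (0 : ℝ) Real.pi,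
      (q : E3) = Real.cos t • (n : E3) + Real.sin t • (v : E3)}

end Hedgehog

end

/-!
The support function `h` extends to a positively homogeneous function `H` of degree one on `ℝ³`,
whose gradient restricts to `x_h` on the sphere and whose second differential at `p` restricts to
`T_p x_h` on `p^⊥`.  If `x_h` is not constant, let `s - s' = w n`, with `w > 0`, be a longest chord
of the hedgehog: then `s` is extremal in the direction `n` and `s'` in the direction `-n`
(`Hedgehog.exists_diameter`).  One of these two directions has the asserted property.

Otherwise the spherical images of `s` and of `s'` both meet every half great circle joining `-n`
and `n`.  Let `v` be a point of the equator orthogonal to `n` with `H v = ⟪s, v⟫`, which is also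
`⟪s', v⟫`.  The function `H - ⟪s, ·⟫` is nonincreasing in the direction `n`, and its gradient
vanishes somewhere on the half great circle through `v`; this forces `⟪x_h v - s, n⟫ = 0`
(`Hedgehog.inner_param_eq_of_forall_meet`), and likewise `⟪x_h v - s', n⟫ = 0`, contradicting
`w > 0`.

Hence `H - ⟪s, ·⟫` has no zero on the equator, and has a constant sign there by connectedness.  Say
it is negative.  In the affine chart `⟪u, n⟫ = 1` it then tends to `-∞` at infinity, even after
adding `ε ‖u‖` for a small `ε > 0`; so it attains a maximum, and there its second differential is
negative definite transversally to the ray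
(`Hedgehog.IsHomogeneousPotential.exists_inner_fderiv_neg`).  A definite endomorphism of a plane
has a positive determinant, which contradicts `R_h ≤ 0`
(`Hedgehog.exists_supportExt_eq_inner_on_equator`).
-/

open Filter Topology

namespace Hedgehog

/-! ### Positively homogeneous functions and their gradient fields -/

lemma add_smul_ne_zero_of_inner_eq_zero {E : Type*} [NormedAddCommGroup E]
    [InnerProductSpace ℝ E] {n v : E} (hv : v ≠ 0) (hnv : ⟪n, v⟫ = 0) (z : ℝ) : v + z • n ≠ 0 := by
  intro h0
  have : ⟪v + z • n, v⟫ = 0 := by rw [h0, inner_zero_left]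
  rw [inner_add_left, real_inner_smul_left, hnv, mul_zero, add_zero] at this
  exact hv (inner_self_eq_zero.1 this)

section Homogeneous

variable {E : Type*} [NormedAddCommGroup E] [InnerProductSpace ℝ E] [CompleteSpace E]

/-- `G` is positively homogeneous of degree one, and away from the origin it has the gradient
field `X`, which is differentiable and positively homogeneous of degree zero. -/
structure IsHomogeneousPotential (G : E → ℝ) (X : E → E) : Prop where
  hasGradientAt : ∀ u, u ≠ 0 → HasGradientAt G (X u) u
  map_smul : ∀ c : ℝ, 0 < c → ∀ u, G (c • u) = c * G u
  field_smul : ∀ c : ℝ, 0 < c → ∀ u, X (c • u) = X u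
  differentiableAt : ∀ u, u ≠ 0 → DifferentiableAt ℝ X u

namespace IsHomogeneousPotential

variable {G : E → ℝ} {X : E → E}

lemma neg (hG : IsHomogeneousPotential G X) :
    IsHomogeneousPotential (fun u => -G u) (fun u => -X u) where
  hasGradientAt u hu := by
    rw [hasGradientAt_iff_hasFDerivAt]
    exact (hG.hasGradientAt u hu).hasFDerivAt.neg.congr_fderiv (by simp)
  map_smul c hc u := by rw [hG.map_smul c hc]; ring
  field_smul c hc u := by rw [hG.field_smul c hc]
  differentiableAt u hu := (hG.differentiableAt u hu).neg

lemma sub_inner (hG : IsHomogeneousPotential G X) (s : E) :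
    IsHomogeneousPotential (fun u => G u - ⟪s, u⟫) (fun u => X u - s) where
  hasGradientAt u hu := by
    rw [hasGradientAt_iff_hasFDerivAt]
    refine ((hG.hasGradientAt u hu).hasFDerivAt.sub
      (innerSL ℝ s).hasFDerivAt).congr_fderiv ?_
    ext y
    simp
  map_smul c hc u := by rw [hG.map_smul c hc, real_inner_smul_right]; ring
  field_smul c hc u := by rw [hG.field_smul c hc]
  differentiableAt u hu := (hG.differentiableAt u hu).sub_const s

lemma hasDerivAt_line (hG : IsHomogeneousPotential G X) {u e : E} {t : ℝ}
    (hu : u + t • e ≠ 0) :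
    HasDerivAt (fun t : ℝ => G (u + t • e)) ⟪X (u + t • e), e⟫ t := by
  have h1 : HasDerivAt (fun t : ℝ => u + t • e) e t := by
    simpa using ((hasDerivAt_id t).smul_const e).const_add u
  exact (hG.hasGradientAt _ hu).hasFDerivAt.comp_hasDerivAt t h1

/-- Euler's relation. -/
lemma inner_field_self (hG : IsHomogeneousPotential G X) {u : E} (hu : u ≠ 0) :
    ⟪X u, u⟫ = G u := by
  have h1 : HasDerivAt (fun t : ℝ => G (u + t • u)) ⟪X u, u⟫ 0 := by
    simpa using hG.hasDerivAt_line (u := u) (e := u) (t := 0) (by simpa using hu)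
  have h2 : HasDerivAt (fun t : ℝ => (1 + t) * G u) (G u) 0 := by
    simpa using ((hasDerivAt_id (0 : ℝ)).const_add 1).mul_const (G u)
  refine h1.unique (h2.congr_of_eventuallyEq ?_)
  filter_upwards [lt_mem_nhds (show (-1 : ℝ) < 0 by norm_num)] with t ht
  rw [← hG.map_smul (1 + t) (by linarith), add_smul, one_smul]

lemma continuousAt (hG : IsHomogeneousPotential G X) {u : E} (hu : u ≠ 0) : ContinuousAt G u :=
  (hG.hasGradientAt u hu).continuousAt

lemma inner_field_eq_zero_aux (hG : IsHomogeneousPotential G X) {n v : E}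
    (hn : n ≠ 0) (hv : v ≠ 0) (hnv : ⟪n, v⟫ = 0)
    (hX : ∀ u, u ≠ 0 → ⟪X u, n⟫ ≤ 0) (hGv : G v = 0)
    {a b : ℝ} (ha : 0 ≤ a) (hb : 0 ≤ b) (hp : a • n + b • v ≠ 0)
    (hX0 : X (a • n + b • v) = 0) : ⟪X v, n⟫ = 0 := by
  by_contra hc
  have hc : ⟪X v, n⟫ < 0 := lt_of_le_of_ne (hX v hv) hc
  have hder (z : ℝ) : HasDerivAt (fun z : ℝ => G (v + z • n)) ⟪X (v + z • n), n⟫ z :=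
    hG.hasDerivAt_line (add_smul_ne_zero_of_inner_eq_zero hv hnv z)
  have hanti : Antitone (fun z : ℝ => G (v + z • n)) :=
    antitone_of_deriv_nonpos (fun z => (hder z).differentiableAt)
      (fun z => by rw [(hder z).deriv]; exact hX _ (add_smul_ne_zero_of_inner_eq_zero hv hnv z))
  have hneg : ∀ z : ℝ, 0 < z → G (v + z • n) < 0 := by
    intro z hz
    by_contra! hge
    have hlim := (hder 0).tendsto_slope_zero_right
    have : (0 : ℝ) ≤ ⟪X (v + (0 : ℝ) • n), n⟫ := by
      refine ge_of_tendsto hlim ?_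
      filter_upwards [Ioo_mem_nhdsGT hz] with t ht
      have h1 : G (v + z • n) ≤ G (v + t • n) := hanti ht.2.le
      simp only [zero_add, zero_smul, add_zero, hGv, sub_zero, smul_eq_mul]
      exact mul_nonneg (inv_nonneg.2 ht.1.le) (hge.trans h1)
    simp only [zero_smul, add_zero] at this
    linarith
  have hGp : G (a • n + b • v) = 0 := by rw [← hG.inner_field_self hp, hX0, inner_zero_left]
  rcases hb.eq_or_lt with rfl | hb
  · -- The zero of the field lies on the ray of `n`.  Near this ray, homogeneity turns the
    -- negative value of `G` at `v + n` into a linear decrease of `G` in the direction `v`.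
    have ha : 0 < a := by
      rcases ha.eq_or_lt with rfl | ha
      · simp at hp
      · exact ha
    simp only [zero_smul, add_zero, hG.field_smul a ha, hG.map_smul a ha] at hX0 hGp
    have hGn : G n = 0 := by simpa [ha.ne'] using hGp
    have hlim := (hG.hasDerivAt_line (u := n) (e := v) (t := 0)
      (by simpa using hn)).tendsto_slope_zero_right
    have : ⟪X (n + (0 : ℝ) • v), v⟫ ≤ G (v + (1 : ℝ) • n) := by
      refine le_of_tendsto hlim ?_
      filter_upwards [Ioo_mem_nhdsGT (zero_lt_one' ℝ)] with t ht
      have h1 : G (v + t⁻¹ • n) ≤ G (v + (1 : ℝ) • n) :=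
        hanti ((one_le_inv₀ ht.1).2 ht.2.le)
      have h2 : n + t • v = t • (v + t⁻¹ • n) := by
        rw [smul_add, smul_smul, mul_inv_cancel₀ ht.1.ne', one_smul, add_comm]
      simp only [zero_add, zero_smul, add_zero, hGn, sub_zero, smul_eq_mul]
      rw [h2, hG.map_smul t ht.1, ← mul_assoc, inv_mul_cancel₀ ht.1.ne', one_mul]
      exact h1
    simp only [zero_smul, add_zero, hX0, inner_zero_left] at this
    linarith [hneg 1 one_pos]
  · have h2 : a • n + b • v = b • (v + (a / b) • n) := by
      rw [smul_add, smul_smul, mul_div_cancel₀ _ hb.ne', add_comm]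
    rw [h2, hG.map_smul b hb] at hGp
    rw [h2, hG.field_smul b hb] at hX0
    rcases ha.eq_or_lt with rfl | ha
    · simp only [zero_div, zero_smul, add_zero] at hX0
      simp [hX0] at hc
    · have := hneg (a / b) (div_pos ha hb)
      rcases mul_eq_zero.1 hGp with h | h <;> linarith

/-- If `G` is nonincreasing in the direction `n` and its gradient vanishes somewhere on the closed
half-plane bounded by `ℝ n` through `v`, then a zero of `G` at `v` forces its derivative in the
direction `n` to vanish at `v`: by monotonicity, `G` vanishes on the part of the line `v + ℝ n`
between `v` and the ray of the zero of the gradient (a half-line, if this ray is parallel to it). -/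
lemma inner_field_eq_zero (hG : IsHomogeneousPotential G X) {n v : E}
    (hn : n ≠ 0) (hv : v ≠ 0) (hnv : ⟪n, v⟫ = 0)
    (hX : ∀ u, u ≠ 0 → ⟪X u, n⟫ ≤ 0) (hGv : G v = 0)
    {a b : ℝ} (hb : 0 ≤ b) (hp : a • n + b • v ≠ 0)
    (hX0 : X (a • n + b • v) = 0) : ⟪X v, n⟫ = 0 := by
  rcases le_total 0 a with ha | ha
  · exact hG.inner_field_eq_zero_aux hn hv hnv hX hGv ha hb hp hX0
  · have hE : (-a) • (-n) + b • v = a • n + b • v := by rw [neg_smul_neg]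
    have := hG.neg.inner_field_eq_zero_aux (n := -n) (v := v) (a := -a) (b := b)
      (neg_ne_zero.2 hn) hv (by rw [inner_neg_left, hnv, neg_zero])
      (fun u hu => by rw [inner_neg_neg]; exact hX u hu) (by rw [hGv, neg_zero])
      (neg_nonneg.2 ha) hb (by rwa [hE]) (by rw [hE, hX0, neg_zero])
    rwa [inner_neg_neg] at this

end IsHomogeneousPotential

/-! ### A second derivative test on a hemisphere -/

lemma nonpos_of_isLocalMax {f g : ℝ → ℝ} {c t₀ : ℝ} (hmax : IsLocalMax f t₀)
    (hf : ∀ᶠ t in 𝓝 t₀, HasDerivAt f (g t) t) (hg : HasDerivAt g c t₀) : c ≤ 0 := by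
  by_contra! hc
  have hd : deriv f =ᶠ[𝓝 t₀] g := hf.mono fun t ht => ht.deriv
  have hdd : deriv (deriv f) t₀ = c := hd.deriv_eq.trans hg.deriv
  have hmin : IsLocalMin f t₀ := isLocalMin_of_deriv_deriv_pos (by rwa [hdd])
    hmax.deriv_eq_zero hf.self_of_nhds.continuousAt
  have hconst : f =ᶠ[𝓝 t₀] fun _ => f t₀ := by
    filter_upwards [hmax, hmin] with t h1 h2 using le_antisymm h1 h2
  have h0 : deriv (deriv f) t₀ = 0 := by
    rw [hconst.deriv.deriv_eq]
    simp
  exact hc.ne' (hdd.symm.trans h0)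

namespace IsHomogeneousPotential

variable {G : E → ℝ} {X : E → E}

/-- If `G` is negative on the equator orthogonal to `n`, then at some point `p` of the open
hemisphere around `n` the second differential of `G` is negative definite on `p^⊥`.  In the
affine chart `⟪u, n⟫ = 1` the function `G + ε ‖u‖` tends to `-∞` at infinity, so that it has a
maximum; as the norm is strictly convex transversally to its rays, `G` is strictly concave there. -/
lemma exists_inner_fderiv_neg [ProperSpace E] (hG : IsHomogeneousPotential G X) {n : E}
    (hn : ‖n‖ = 1) (hneg : ∀ v, ‖v‖ = 1 → ⟪v, n⟫ = 0 → G v < 0) :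
    ∃ p : E, ‖p‖ = 1 ∧ ∀ e : E, e ≠ 0 → ⟪p, e⟫ = 0 → ⟪fderiv ℝ X p e, e⟫ < 0 := by
  have ne0 : ∀ u : E, ‖u‖ = 1 → u ≠ 0 := fun u hu h0 => by simp [h0] at hu
  have hcont : ContinuousOn G (Metric.sphere 0 1) := fun u hu =>
    (hG.continuousAt (ne0 u (mem_sphere_zero_iff_norm.1 hu))).continuousWithinAt
  obtain ⟨ε, hε, hGε⟩ : ∃ ε > 0, ∀ v, ‖v‖ = 1 → ⟪v, n⟫ = 0 → G v + ε < 0 := by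
    have hK : IsCompact (Metric.sphere (0 : E) 1 ∩ {v | ⟪v, n⟫ = 0}) :=
      (isCompact_sphere 0 1).inter_right (isClosed_eq (by fun_prop) continuous_const)
    rcases (Metric.sphere (0 : E) 1 ∩ {v | ⟪v, n⟫ = 0}).eq_empty_or_nonempty with h0 | hne
    · refine ⟨1, one_pos, fun v hv hvn => ?_⟩
      have : v ∈ (∅ : Set E) := h0 ▸ ⟨mem_sphere_zero_iff_norm.2 hv, hvn⟩
      exact this.elim
    · obtain ⟨w, hw, hmax⟩ := hK.exists_isMaxOn hne (hcont.mono Set.inter_subset_left)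
      have hGw := hneg w (mem_sphere_zero_iff_norm.1 hw.1) hw.2
      refine ⟨-G w / 2, by linarith, fun v hv hvn => ?_⟩
      have : G v ≤ G w := hmax ⟨mem_sphere_zero_iff_norm.2 hv, hvn⟩
      linarith
  -- On `A` the quotient `(G + ε) / ⟪·, n⟫` is at least its value `G n + ε` at `n`, and `A` does
  -- not meet the equator.
  let A : Set E := {p | p ∈ Metric.sphere (0 : E) 1 ∧ (G n + ε) * ⟪p, n⟫ ≤ G p + ε} ∩
    {p | 0 ≤ ⟪p, n⟫}
  have hA : IsCompact A := by
    refine ((isCompact_sphere (0 : E) 1).of_isClosed_subset ?_ (fun p hp => hp.1)).inter_right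
      (isClosed_le continuous_const (by fun_prop))
    exact Metric.isClosed_sphere.isClosed_le (by fun_prop) (hcont.add continuousOn_const)
  have hnn : ⟪n, n⟫ = 1 := by rw [real_inner_self_eq_norm_sq, hn, one_pow]
  have hnA : n ∈ A := ⟨⟨mem_sphere_zero_iff_norm.2 hn, by rw [hnn, mul_one]⟩, by simp⟩
  have hApos : ∀ p ∈ A, 0 < ⟪p, n⟫ := by
    intro p hp
    refine lt_of_le_of_ne hp.2 fun h0 => ?_
    have h1 := hp.1.2
    rw [← h0, mul_zero] at h1
    exact absurd (hGε p (mem_sphere_zero_iff_norm.1 hp.1.1) h0.symm) (not_lt.2 h1)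
  obtain ⟨p, hpA, hpmax⟩ := hA.exists_isMaxOn (f := fun p => (G p + ε) / ⟪p, n⟫) ⟨n, hnA⟩
    (ContinuousOn.div ((hcont.mono fun p hp => hp.1.1).add continuousOn_const) (by fun_prop)
      fun p hp => (hApos p hp).ne')
  have hp1 : ‖p‖ = 1 := mem_sphere_zero_iff_norm.1 hpA.1.1
  have hpn := hApos p hpA
  set M := (G p + ε) / ⟪p, n⟫ with hM
  have hMp : G p + ε = M * ⟪p, n⟫ := by rw [hM, div_mul_cancel₀ _ hpn.ne']
  have hML : G n + ε ≤ M := by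
    have : (G n + ε) / ⟪n, n⟫ ≤ M := hpmax hnA
    rwa [hnn, div_one] at this
  have hsph : ∀ q, ‖q‖ = 1 → 0 < ⟪q, n⟫ → G q + ε ≤ M * ⟪q, n⟫ := by
    intro q hq hqn
    by_cases hqA : q ∈ A
    · have : (G q + ε) / ⟪q, n⟫ ≤ M := hpmax hqA
      rwa [div_le_iff₀ hqn] at this
    · have h1 : G q + ε < (G n + ε) * ⟪q, n⟫ := by
        by_contra! h1
        exact hqA ⟨⟨mem_sphere_zero_iff_norm.2 hq, h1⟩, hqn.le⟩
      exact h1.le.trans (mul_le_mul_of_nonneg_right hML hqn.le)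
  have hall : ∀ u, 0 < ⟪u, n⟫ → G u + ε * ‖u‖ ≤ M * ⟪u, n⟫ := by
    intro u hu
    have hu0 : u ≠ 0 := fun h0 => by simp [h0] at hu
    have hr : 0 < ‖u‖ := norm_pos_iff.2 hu0
    have h1 := hsph (‖u‖⁻¹ • u) (by rw [norm_smul, norm_inv, norm_norm, inv_mul_cancel₀ hr.ne'])
      (by rw [real_inner_smul_left]; positivity)
    rw [hG.map_smul _ (inv_pos.2 hr), real_inner_smul_left] at h1
    have h2 := mul_le_mul_of_nonneg_left h1 hr.le
    calc G u + ε * ‖u‖ = ‖u‖ * (‖u‖⁻¹ * G u + ε) := by field_simp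
      _ ≤ ‖u‖ * (M * (‖u‖⁻¹ * ⟪u, n⟫)) := h2
      _ = M * ⟪u, n⟫ := by field_simp
  refine ⟨p, hp1, fun e he hpe => ?_⟩
  have hp0 : p ≠ 0 := ne0 p hp1
  have hline : Tendsto (fun t : ℝ => p + t • e) (𝓝 0) (𝓝 p) := by
    have : Continuous fun t : ℝ => p + t • e := by fun_prop
    simpa using this.tendsto 0
  have hnorm : ∀ t : ℝ, ‖p + t • e‖ ^ 2 = 1 + t ^ 2 * ‖e‖ ^ 2 := by
    intro t
    rw [norm_add_sq_real, real_inner_smul_right, hpe, hp1, norm_smul, mul_pow, Real.norm_eq_abs,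
      sq_abs]
    ring
  -- Since `1 + x / 3 ≤ √(1 + x)` for `0 ≤ x ≤ 3`, the norm may be replaced by a quadratic
  -- polynomial in `t`.
  let k : ℝ → ℝ := fun t =>
    G (p + t • e) + ε * (1 + t ^ 2 * ‖e‖ ^ 2 / 3) - M * ⟪p + t • e, n⟫
  have hk0 : k 0 = 0 := by simp [k, hMp]
  have hkmax : IsLocalMax k 0 := by
    have hsmall : ∀ᶠ t : ℝ in 𝓝 0, t ^ 2 * ‖e‖ ^ 2 < 3 := by
      have : Continuous fun t : ℝ => t ^ 2 * ‖e‖ ^ 2 := by fun_prop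
      exact (this.tendsto 0).eventually (gt_mem_nhds (by norm_num))
    have hhemi : ∀ᶠ t : ℝ in 𝓝 0, 0 < ⟪p + t • e, n⟫ := by
      have : Continuous fun t : ℝ => ⟪p + t • e, n⟫ := by fun_prop
      exact (this.tendsto 0).eventually (lt_mem_nhds (by simpa using hpn))
    filter_upwards [hsmall, hhemi] with t h1 h2
    rw [hk0]
    have h3 := hall _ h2
    have h4 : 1 + t ^ 2 * ‖e‖ ^ 2 / 3 ≤ ‖p + t • e‖ := by
      refine le_of_sq_le_sq ?_ (norm_nonneg _)
      rw [hnorm]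
      have : 0 ≤ t ^ 2 * ‖e‖ ^ 2 := by positivity
      nlinarith
    have h5 := mul_le_mul_of_nonneg_left h4 hε.le
    simp only [k]
    linarith
  have hk' : ∀ᶠ t in 𝓝 (0 : ℝ), HasDerivAt k
      (⟪X (p + t • e), e⟫ + ε * (2 * t * ‖e‖ ^ 2 / 3) - M * ⟪e, n⟫) t := by
    filter_upwards [hline.eventually (isOpen_ne.mem_nhds hp0)] with t ht
    have h1 := hG.hasDerivAt_line ht
    have h2 : HasDerivAt (fun t : ℝ => ε * (1 + t ^ 2 * ‖e‖ ^ 2 / 3))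
        (ε * (2 * t * ‖e‖ ^ 2 / 3)) t := by
      simpa using (((((hasDerivAt_id t).pow 2).mul_const (‖e‖ ^ 2)).div_const 3).const_add
        1).const_mul ε
    have h3 : HasDerivAt (fun t : ℝ => M * ⟪p + t • e, n⟫) (M * ⟪e, n⟫) t := by
      simp only [inner_add_left, real_inner_smul_left]
      simpa using (((hasDerivAt_id t).mul_const ⟪e, n⟫).const_add ⟪p, n⟫).const_mul M
    exact (h1.add h2).sub h3
  have hk'' : HasDerivAt
      (fun t : ℝ => ⟪X (p + t • e), e⟫ + ε * (2 * t * ‖e‖ ^ 2 / 3) - M * ⟪e, n⟫)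
      (⟪fderiv ℝ X p e, e⟫ + ε * (2 * ‖e‖ ^ 2 / 3)) 0 := by
    have h0 : HasDerivAt (fun t : ℝ => p + t • e) e 0 := by
      simpa using ((hasDerivAt_id (0 : ℝ)).smul_const e).const_add p
    have h1 : HasDerivAt (fun t : ℝ => X (p + t • e)) (fderiv ℝ X p e) 0 := by
      have hd : HasFDerivAt X (fderiv ℝ X p) (p + (0 : ℝ) • e) := by
        simpa using (hG.differentiableAt p hp0).hasFDerivAt
      exact hd.comp_hasDerivAt 0 h0
    have h2 : HasDerivAt (fun t : ℝ => ⟪X (p + t • e), e⟫) ⟪fderiv ℝ X p e, e⟫ 0 := by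
      simpa using h1.inner ℝ (hasDerivAt_const (0 : ℝ) e)
    have h3 : HasDerivAt (fun t : ℝ => ε * (2 * t * ‖e‖ ^ 2 / 3)) (ε * (2 * ‖e‖ ^ 2 / 3)) 0 := by
      simpa using (((((hasDerivAt_id (0 : ℝ)).const_mul 2).mul_const (‖e‖ ^ 2)).div_const
        3)).const_mul ε
    exact (h2.add h3).sub_const _
  have hfin := nonpos_of_isLocalMax hkmax hk' hk''
  have : 0 < ε * (2 * ‖e‖ ^ 2 / 3) := by
    have := norm_pos_iff.2 he
    positivity
  linarith

end IsHomogeneousPotential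

end Homogeneous

/-! ### Definite endomorphisms of a plane -/

/-- The determinant of a negative definite endomorphism of a plane is positive, symmetric or not:
if the matrix is `(a, b; c, d)`, then `4 a d > (b + c)² ≥ 4 b c`. -/
lemma det_pos_of_inner_neg {V : Type*} [NormedAddCommGroup V] [InnerProductSpace ℝ V]
    [FiniteDimensional ℝ V] (hV : Module.finrank ℝ V = 2) (T : V →ₗ[ℝ] V)
    (hT : ∀ e, e ≠ 0 → ⟪T e, e⟫ < 0) : 0 < LinearMap.det T := by
  let B := (stdOrthonormalBasis ℝ V).reindex (finCongr hV)
  have hB : ∀ i j, LinearMap.toMatrix B.toBasis B.toBasis T i j = ⟪B i, T (B j)⟫ := by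
    intro i j
    rw [LinearMap.toMatrix_apply, OrthonormalBasis.coe_toBasis,
      OrthonormalBasis.coe_toBasis_repr_apply, OrthonormalBasis.repr_apply_apply]
  rw [← LinearMap.det_toMatrix B.toBasis, Matrix.det_fin_two, hB, hB, hB, hB]
  have h01 : LinearIndependent ℝ B := B.orthonormal.linearIndependent
  have hq : ∀ x y : ℝ, x ≠ 0 ∨ y ≠ 0 → x ^ 2 * ⟪B 0, T (B 0)⟫ +
      x * y * (⟪B 0, T (B 1)⟫ + ⟪B 1, T (B 0)⟫) + y ^ 2 * ⟪B 1, T (B 1)⟫ < 0 := by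
    intro x y hxy
    have hne : x • B 0 + y • B 1 ≠ 0 := by
      intro h0
      have h2 := Fintype.linearIndependent_iff.1 h01 ![x, y] (by simpa [Fin.sum_univ_two] using h0)
      rcases hxy with h | h
      · exact h (h2 0)
      · exact h (h2 1)
    have h := hT _ hne
    rw [real_inner_comm] at h
    simp only [map_add, map_smul, inner_add_left, inner_add_right, real_inner_smul_left,
      real_inner_smul_right] at h
    linarith
  have ha : ⟪B 0, T (B 0)⟫ < 0 := by simpa using hq 1 0 (by simp)
  set a := ⟪B 0, T (B 0)⟫
  set b := ⟪B 0, T (B 1)⟫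
  set c := ⟪B 1, T (B 0)⟫
  set d := ⟪B 1, T (B 1)⟫
  -- At `(b + c, -2 a)` the quadratic form takes the value `a (4 a d - (b + c)²)`.
  have h := hq (b + c) (-2 * a) (Or.inr (by linarith [mul_pos_of_neg_of_neg ha ha, ha]))
  have h' : a * (4 * (a * d) - (b + c) ^ 2) < 0 := by linarith
  have h2 : 0 < 4 * (a * d) - (b + c) ^ 2 := by
    by_contra! h3
    linarith [mul_nonneg_of_nonpos_of_nonpos ha.le h3]
  linarith [sq_nonneg (b - c)]

/-! ### The homogeneous extension of a support function -/

lemma radialExt_of_ne_zero {F : Type*} [Zero F] (g : S2 → F) {u : E3} (hu : u ≠ 0) :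
    radialExt g u = g (toSphere u hu) := by
  simp [radialExt, hu]

lemma radialExt_coe {F : Type*} [Zero F] (g : S2 → F) (p : S2) :
    radialExt g (p : E3) = g p := by
  rw [radialExt_of_ne_zero g (ne_zero_of_mem_unit_sphere p)]
  congr 1
  ext1
  simp [toSphere]

lemma radialExt_smul {F : Type*} [Zero F] (g : S2 → F) {c : ℝ} (hc : 0 < c) (u : E3) :
    radialExt g (c • u) = radialExt g u := by
  by_cases hu : u = 0
  · simp [hu]
  · have hcu : c • u ≠ 0 := smul_ne_zero hc.ne' hu
    rw [radialExt_of_ne_zero g hu, radialExt_of_ne_zero g hcu]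
    congr 1
    ext1
    simp only [toSphere, norm_smul, Real.norm_eq_abs, abs_of_pos hc, mul_inv, smul_smul]
    congr 1
    field_simp

/-- The positively homogeneous extension `u ↦ ‖u‖ h (u / ‖u‖)` of a support function. -/
noncomputable def supportExt (h : S2 → ℝ) (u : E3) : ℝ := ‖u‖ * radialExt h u

lemma supportExt_smul (h : S2 → ℝ) {c : ℝ} (hc : 0 < c) (u : E3) :
    supportExt h (c • u) = c * supportExt h u := by
  rw [supportExt, supportExt, radialExt_smul h hc, norm_smul, Real.norm_eq_abs, abs_of_pos hc,
    mul_assoc]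

lemma contDiffAt_radialExt {h : S2 → ℝ} (hh : ContMDiff (𝓡 2) 𝓘(ℝ, ℝ) 2 h) {u : E3}
    (hu : u ≠ 0) : ContDiffAt ℝ 2 (radialExt h) u := by
  have : Fact (Module.finrank ℝ E3 = 2 + 1) := ⟨finrank_euclideanSpace_fin⟩
  let U : TopologicalSpace.Opens E3 := ⟨{0}ᶜ, isOpen_compl_singleton⟩
  have h1 : ContMDiff 𝓘(ℝ, E3) 𝓘(ℝ, E3) 2 (fun x : U => ‖(x : E3)‖⁻¹ • (x : E3)) := by
    intro x
    have hx : (x : E3) ≠ 0 := x.2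
    refine contMDiffAt_subtype_iff (f := fun y : E3 => ‖y‖⁻¹ • y).2 ?_
    exact (((contDiffAt_norm ℝ hx).inv (norm_ne_zero_iff.2 hx)).smul contDiffAt_id).contMDiffAt
  have h2 := h1.codRestrict_sphere (n := 2) (fun x => (toSphere (x : E3) x.2).2)
  have h3 := hh.comp h2
  rw [← contMDiffAt_iff_contDiffAt]
  refine (contMDiffAt_subtype_iff (U := U) (x := ⟨u, hu⟩)).1 ?_
  refine (h3 ⟨u, hu⟩).congr_of_eventuallyEq (Eventually.of_forall fun x => ?_)
  exact radialExt_of_ne_zero h x.2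

lemma contDiffAt_supportExt {h : S2 → ℝ} (hh : ContMDiff (𝓡 2) 𝓘(ℝ, ℝ) 2 h) {u : E3}
    (hu : u ≠ 0) : ContDiffAt ℝ 2 (supportExt h) u :=
  (contDiffAt_norm ℝ hu).mul (contDiffAt_radialExt hh hu)

lemma hasGradientAt_supportExt_coe {h : S2 → ℝ} (hh : ContMDiff (𝓡 2) 𝓘(ℝ, ℝ) 2 h) (p : S2) :
    HasGradientAt (supportExt h) (param h p) (p : E3) := by
  have hp := ne_zero_of_mem_unit_sphere p
  have hp1 : ‖(p : E3)‖ = 1 := norm_eq_of_mem_sphere p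
  have h1 := ((contDiffAt_radialExt hh hp).differentiableAt (by norm_num)).hasGradientAt
  have h2 : HasFDerivAt (fun u : E3 => ‖u‖) (innerSL ℝ (p : E3)) (p : E3) := by
    have h3 := ((hasStrictFDerivAt_norm_sq (p : E3)).hasFDerivAt).sqrt (by simp [hp1])
    simp only [Real.sqrt_sq (norm_nonneg _), hp1] at h3
    refine h3.congr_fderiv ?_
    ext y
    simp
  have h3 := h2.mul h1.hasFDerivAt
  rw [hasGradientAt_iff_hasFDerivAt]
  refine h3.congr_fderiv ?_
  ext y
  simp [param, sphereGrad, hp1, radialExt_coe]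

/-- The parametrization of a hedgehog is the restriction to the sphere of the gradient of the
homogeneous extension of its support function. -/
lemma isHomogeneousPotential_supportExt {h : S2 → ℝ}
    (hh : ContMDiff (𝓡 2) 𝓘(ℝ, ℝ) 2 h) :
    IsHomogeneousPotential (supportExt h) (radialExt (param h)) := by
  have hgrad : ∀ u : E3, u ≠ 0 → HasGradientAt (supportExt h) (radialExt (param h) u) u := by
    intro u hu
    have hr : 0 < ‖u‖ := norm_pos_iff.2 hu
    rw [radialExt_of_ne_zero _ hu, hasGradientAt_iff_hasFDerivAt]
    have h1 := (hasGradientAt_supportExt_coe hh (toSphere u hu)).hasFDerivAt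
    have h2 : HasFDerivAt (fun w : E3 => ‖u‖⁻¹ • w) (‖u‖⁻¹ • ContinuousLinearMap.id ℝ E3) u :=
      (‖u‖⁻¹ • ContinuousLinearMap.id ℝ E3).hasFDerivAt
    have h3 := (HasFDerivAt.comp u h1 h2).const_mul ‖u‖
    have h4 : (fun w => ‖u‖ * (supportExt h ∘ fun w : E3 => ‖u‖⁻¹ • w) w) = supportExt h := by
      funext w
      rw [Function.comp_apply, supportExt_smul h (inv_pos.2 hr), mul_inv_cancel_left₀ hr.ne']
    rw [h4] at h3
    refine h3.congr_fderiv ?_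
    ext y
    simp [hr.ne']
  refine ⟨hgrad, fun c hc u => supportExt_smul h hc u, fun c hc u => radialExt_smul _ hc u, ?_⟩
  intro u hu
  have h1 : DifferentiableAt ℝ (fderiv ℝ (supportExt h)) u :=
    ((contDiffAt_supportExt hh hu).fderiv_right (m := 1) (by norm_num)).differentiableAt
      (by norm_num)
  have h2 : DifferentiableAt ℝ
      (fun w => (InnerProductSpace.toDual ℝ E3).symm (fderiv ℝ (supportExt h) w)) u :=
    (InnerProductSpace.toDual ℝ E3).symm.differentiable.differentiableAt.comp u h1
  refine h2.congr_of_eventuallyEq ?_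
  filter_upwards [isOpen_ne.mem_nhds hu] with w hw
  exact (hgrad w hw).gradient.symm

lemma finrank_tangentPlane (p : S2) : Module.finrank ℝ (tangentPlane p) = 2 :=
  have : Fact (Module.finrank ℝ E3 = 2 + 1) := ⟨finrank_euclideanSpace_fin⟩
  Submodule.finrank_orthogonal_span_singleton (ne_zero_of_mem_unit_sphere p)

lemma inner_tangentEnd (h : S2 → ℝ) (p : S2) (e : tangentPlane p) :
    ⟪tangentEnd h p e, e⟫ = ⟪fderiv ℝ (radialExt (param h)) (p : E3) e, (e : E3)⟫ := by
  simp [tangentEnd]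

lemma inner_coe_tangentPlane (p : S2) (e : tangentPlane p) : ⟪(p : E3), (e : E3)⟫ = 0 :=
  Submodule.mem_orthogonal_singleton_iff_inner_right.1 e.2

lemma curvature_pos_of_inner_neg (h : S2 → ℝ) (p : S2)
    (hneg : ∀ e : E3, e ≠ 0 → ⟪(p : E3), e⟫ = 0 →
      ⟪fderiv ℝ (radialExt (param h)) (p : E3) e, e⟫ < 0) : 0 < curvature h p := by
  refine det_pos_of_inner_neg (finrank_tangentPlane p) _ fun e he => ?_
  rw [ContinuousLinearMap.coe_coe, inner_tangentEnd]
  exact hneg e (by simpa using he) (inner_coe_tangentPlane p e)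

lemma curvature_pos_of_inner_pos (h : S2 → ℝ) (p : S2)
    (hpos : ∀ e : E3, e ≠ 0 → ⟪(p : E3), e⟫ = 0 →
      0 < ⟪fderiv ℝ (radialExt (param h)) (p : E3) e, e⟫) : 0 < curvature h p := by
  have h1 : 0 < LinearMap.det (-(tangentEnd h p : tangentPlane p →ₗ[ℝ] tangentPlane p)) := by
    refine det_pos_of_inner_neg (finrank_tangentPlane p) _ fun e he => ?_
    rw [LinearMap.neg_apply, inner_neg_left, ContinuousLinearMap.coe_coe, inner_tangentEnd]
    exact neg_neg_of_pos (hpos e (by simpa using he) (inner_coe_tangentPlane p e))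
  rw [← neg_one_smul ℝ, LinearMap.det_smul, finrank_tangentPlane] at h1
  simpa [curvature] using h1

/-! ### Sign on the equator -/

/-- A great circle is connected, so a continuous function without zeros on it has constant sign. -/
lemma neg_or_pos_of_ne_zero_on_equator (G : E3 → ℝ) (hG : ∀ u, u ≠ 0 → ContinuousAt G u) (n : S2)
    (hne : ∀ v : E3, ‖v‖ = 1 → ⟪v, (n : E3)⟫ = 0 → G v ≠ 0) :
    (∀ v : E3, ‖v‖ = 1 → ⟪v, (n : E3)⟫ = 0 → G v < 0) ∨
      (∀ v : E3, ‖v‖ = 1 → ⟪v, (n : E3)⟫ = 0 → 0 < G v) := by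
  have hconn : IsPreconnected (Metric.sphere (0 : tangentPlane n) 1) := by
    refine (isConnected_sphere ?_ 0 zero_le_one).isPreconnected
    rw [← Module.finrank_eq_rank, finrank_tangentPlane]
    norm_num
  have hcont : ContinuousOn (fun v : tangentPlane n => G v) (Metric.sphere 0 1) := by
    intro v hv
    have hv0 : (v : E3) ≠ 0 := by
      intro h0
      have : v = 0 := by simpa using h0
      simp [this] at hv
    exact ((hG v hv0).comp continuous_subtype_val.continuousAt).continuousWithinAt
  by_contra! hcon
  obtain ⟨⟨v, hv, hvn, hGv⟩, w, hw, hwn, hGw⟩ := hcon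
  have hmem : ∀ v : E3, ⟪v, (n : E3)⟫ = 0 → v ∈ tangentPlane n := fun v hv =>
    Submodule.mem_orthogonal_singleton_iff_inner_left.2 hv
  obtain ⟨x, hx, hGx⟩ := hconn.intermediate_value (a := ⟨w, hmem w hwn⟩) (b := ⟨v, hmem v hvn⟩)
    (by simpa using hw) (by simpa using hv) hcont ⟨hGw, hGv⟩
  refine hne x (by simpa using hx) ?_ hGx
  rw [real_inner_comm]
  exact inner_coe_tangentPlane n x

/-- If the curvature is nowhere positive, every translate of the hedgehog has a support function
with a zero on every great circle: otherwise the translated support function has a constant sign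
there, and the second derivative test yields a point of positive curvature. -/
lemma exists_supportExt_eq_inner_on_equator {h : S2 → ℝ} (hh : ContMDiff (𝓡 2) 𝓘(ℝ, ℝ) 2 h)
    (hcurv : ∀ p : S2, curvature h p ≤ 0) (n : S2) (s : E3) :
    ∃ v : S2, ⟪(n : E3), (v : E3)⟫ = 0 ∧ supportExt h v = ⟪s, (v : E3)⟫ := by
  by_contra! hcon
  have hH := (isHomogeneousPotential_supportExt hh).sub_inner s
  have hn1 : ‖(n : E3)‖ = 1 := norm_eq_of_mem_sphere n
  rcases neg_or_pos_of_ne_zero_on_equator _ (fun u hu => hH.continuousAt hu) n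
    (fun v hv hvn => sub_ne_zero.2 (hcon ⟨v, mem_sphere_zero_iff_norm.2 hv⟩
      (by rwa [real_inner_comm]))) with hs | hs
  · obtain ⟨r, hr, hdef⟩ := hH.exists_inner_fderiv_neg hn1 hs
    lift r to S2 using mem_sphere_zero_iff_norm.2 hr
    refine (hcurv r).not_gt (curvature_pos_of_inner_neg h r fun e he hre => ?_)
    simpa only [fderiv_sub_const] using hdef e he hre
  · obtain ⟨r, hr, hdef⟩ := hH.neg.exists_inner_fderiv_neg hn1
      (fun v hv hvn => neg_neg_of_pos (hs v hv hvn))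
    lift r to S2 using mem_sphere_zero_iff_norm.2 hr
    refine (hcurv r).not_gt (curvature_pos_of_inner_pos h r fun e he hre => ?_)
    have h1 := hdef e he hre
    rw [fderiv_fun_neg, fderiv_sub_const, neg_apply, inner_neg_left] at h1
    exact neg_neg_iff_pos.1 h1

/-! ### The direction of a diameter -/

lemma continuous_param {h : S2 → ℝ} (hh : ContMDiff (𝓡 2) 𝓘(ℝ, ℝ) 2 h) :
    Continuous (param h) := by
  have h1 : Continuous fun p : S2 => radialExt (param h) (p : E3) :=
    continuous_iff_continuousAt.2 fun p =>
      ((isHomogeneousPotential_supportExt hh).differentiableAt p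
        (ne_zero_of_mem_unit_sphere p)).continuousAt.comp continuous_subtype_val.continuousAt
  simpa only [radialExt_coe] using h1

/-- If `z` is not farther from `y` than `x` is, then it does not lie beyond `x` in the direction
`x - y`. -/
lemma inner_le_of_dist_le {E : Type*} [NormedAddCommGroup E] [InnerProductSpace ℝ E] {x y z : E}
    (h : dist z y ≤ dist x y) : ⟪z, x - y⟫ ≤ ⟪x, x - y⟫ := by
  rw [dist_eq_norm, dist_eq_norm] at h
  have h1 : ⟪z - y, x - y⟫ ≤ ⟪x - y, x - y⟫ := by
    rw [real_inner_self_eq_norm_mul_norm]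
    exact (real_inner_le_norm _ _).trans (mul_le_mul_of_nonneg_right h (norm_nonneg _))
  rw [inner_sub_left, inner_sub_left _ _ (x - y)] at h1
  linarith

/-- The end points of a diameter of the hedgehog are extremal in the two opposite directions of the
diameter. -/
lemma exists_diameter {h : S2 → ℝ} (hh : ContMDiff (𝓡 2) 𝓘(ℝ, ℝ) 2 h)
    (hpoint : ¬ ∃ a : E3, hedgehog h = {a}) :
    ∃ (n : S2) (s s' : E3) (w : ℝ), 0 < w ∧ s - s' = w • (n : E3) ∧
      IsExtremalPoint h n s ∧ IsExtremalPoint h (-n) s' := by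
  have hcont := continuous_param hh
  have hne : Nonempty S2 := (NormedSpace.sphere_nonempty.2 zero_le_one).to_subtype
  obtain ⟨⟨p, q⟩, hpq⟩ : ∃ x : S2 × S2, ∀ y : S2 × S2,
      dist (param h y.1) (param h y.2) ≤ dist (param h x.1) (param h x.2) := by
    obtain ⟨x, -, hx⟩ := isCompact_univ.exists_isMaxOn (Set.univ_nonempty (α := S2 × S2))
      (f := fun x : S2 × S2 => dist (param h x.1) (param h x.2))
      ((hcont.comp continuous_fst).dist (hcont.comp continuous_snd)).continuousOn
    exact ⟨x, fun y => hx (Set.mem_univ y)⟩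
  have hmax : ∀ a b : S2, dist (param h a) (param h b) ≤ dist (param h p) (param h q) :=
    fun a b => hpq (a, b)
  have hd0 : param h p - param h q ≠ 0 := by
    intro h0
    rw [sub_eq_zero] at h0
    refine hpoint ⟨param h p, Set.eq_singleton_iff_unique_mem.2 ⟨⟨p, rfl⟩, ?_⟩⟩
    rintro _ ⟨a, rfl⟩
    have h1 := hmax a p
    rw [← h0, dist_self] at h1
    exact dist_le_zero.1 h1
  have hdpos : 0 < ‖param h p - param h q‖ := norm_pos_iff.2 hd0
  refine ⟨toSphere _ hd0, param h p, param h q, _, hdpos, ?_, ⟨⟨p, rfl⟩, fun a => ?_⟩,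
    ⟨⟨q, rfl⟩, fun a => ?_⟩⟩
  · rw [toSphere, smul_inv_smul₀ hdpos.ne']
  · rw [toSphere, real_inner_smul_right, real_inner_smul_right]
    exact mul_le_mul_of_nonneg_left (inner_le_of_dist_le (hmax a q)) (inv_nonneg.2 hdpos.le)
  · have h1 := inner_le_of_dist_le ((hmax a p).trans_eq (dist_comm _ _))
    rw [coe_neg_sphere, toSphere, ← smul_neg, neg_sub, real_inner_smul_right,
      real_inner_smul_right]
    exact mul_le_mul_of_nonneg_left h1 (inv_nonneg.2 hdpos.le)

/-! ### Spherical images meeting every half great circle -/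

/-- The half great circle through `v` lies in the closed half-plane bounded by `ℝ n` that contains
`v`, so that a spherical image meeting it has a point in this half-plane. -/
lemma exists_param_eq_of_forall_meet {h : S2 → ℝ} {n v : S2} {s : E3}
    (hnv : ⟪(n : E3), (v : E3)⟫ = 0)
    (hmeet : ∀ C, IsHalfGreatCircle n C → ¬ Disjoint (param h ⁻¹' {s}) C) :
    ∃ a b : ℝ, 0 ≤ b ∧ a • (n : E3) + b • (v : E3) ≠ 0 ∧
      radialExt (param h) (a • (n : E3) + b • (v : E3)) = s := by
  obtain ⟨p, hps, t, ht, hp⟩ := Set.not_disjoint_iff.1 (hmeet _ ⟨v, hnv, rfl⟩)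
  refine ⟨Real.cos t, Real.sin t, Real.sin_nonneg_of_nonneg_of_le_pi ht.1 ht.2, ?_, ?_⟩
  · rw [← hp]
    exact ne_zero_of_mem_unit_sphere p
  · rw [← hp, radialExt_coe]
    exact hps

/-- If the spherical image of an extremal point `s` in the direction `n` meets every half great
circle joining `-n` and `n`, then `x_h v - s` is orthogonal to `n` for each `v` on the equator at
which the support function of the hedgehog translated by `-s` vanishes. -/
lemma inner_param_eq_of_forall_meet {h : S2 → ℝ} (hh : ContMDiff (𝓡 2) 𝓘(ℝ, ℝ) 2 h) {n v : S2}
    {s : E3} (hs : IsExtremalPoint h n s) (hnv : ⟪(n : E3), (v : E3)⟫ = 0)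
    (hv : supportExt h v = ⟪s, (v : E3)⟫)
    (hmeet : ∀ C, IsHalfGreatCircle n C → ¬ Disjoint (param h ⁻¹' {s}) C) :
    ⟪param h v, (n : E3)⟫ = ⟪s, (n : E3)⟫ := by
  obtain ⟨a, b, hb, hne, hab⟩ := exists_param_eq_of_forall_meet hnv hmeet
  have h1 := ((isHomogeneousPotential_supportExt hh).sub_inner s).inner_field_eq_zero
    (ne_zero_of_mem_unit_sphere n) (ne_zero_of_mem_unit_sphere v) hnv
    (fun u hu => by
      rw [inner_sub_left, radialExt_of_ne_zero _ hu, sub_nonpos]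
      exact hs.2 _) (sub_eq_zero.2 hv) hb hne (sub_eq_zero.2 hab)
  rwa [radialExt_coe, inner_sub_left, sub_eq_zero] at h1

end Hedgehog

theorem mainTheorem2 (h : Hedgehog.S2 → ℝ)
    (hh : ContMDiff (𝓡 2) 𝓘(ℝ, ℝ) 2 h)
    (hcurv : ∀ p : Hedgehog.S2, Hedgehog.curvature h p ≤ 0)
    (hpoint : ¬ ∃ a : Hedgehog.E3, Hedgehog.hedgehog h = {a}) :
    ∃ (n : Hedgehog.S2) (s : Hedgehog.E3), Hedgehog.IsExtremalPoint h n s ∧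
      ∃ C : Set Hedgehog.S2, Hedgehog.IsHalfGreatCircle n C ∧
        Disjoint (Hedgehog.param h ⁻¹' {s}) C := by
  by_contra! hcon
  obtain ⟨n, s, s', w, hw, hd, hs, hs'⟩ := Hedgehog.exists_diameter hh hpoint
  obtain ⟨v, hnv, hv⟩ := Hedgehog.exists_supportExt_eq_inner_on_equator hh hcurv n s
  -- The support functions of the translates by `-s` and `-s'` agree at `v`, as `s - s'` is
  -- parallel to `n`.
  have hv' : Hedgehog.supportExt h v = ⟪s', (v : Hedgehog.E3)⟫ := by
    rw [hv, ← sub_eq_zero, ← inner_sub_left, hd, real_inner_smul_left, hnv, mul_zero]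
  have h1 := Hedgehog.inner_param_eq_of_forall_meet hh hs hnv hv (hcon n s hs)
  have h2 := Hedgehog.inner_param_eq_of_forall_meet hh hs'
    (by rw [coe_neg_sphere, inner_neg_left, hnv, neg_zero]) hv' (hcon (-n) s' hs')
  rw [coe_neg_sphere, inner_neg_right, inner_neg_right, neg_inj] at h2
  have h3 : ⟪s - s', (n : Hedgehog.E3)⟫ = 0 := by rw [inner_sub_left, ← h1, ← h2, sub_self]
  rw [hd, real_inner_smul_left, real_inner_self_eq_norm_sq, norm_eq_of_mem_sphere n] at h3
  linarith
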